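/- Let $p$ be a prime and let $G$ be a finite $p$-group. Let $C(G)$ be the set of cyclic subgroups of $G$, ordered by inclusion. A *breaking point* of $C(G)$ is a cyclic subgroup $H$ of $G$ with $1 \neq H \neq G$ such that for every cyclic subgroup $X$ of $G$ we have $X \le H$ or $H \le X$. A *generalized quaternion 2-group* is a group isomorphic, for some natural number $n \ge 3$, to the group of order $2^n$ $$Q_{2^n} = \langle a, b \mid a^{2^{n-2}} = b^2,\ a^{2^{n-1}} = 1,\ b^{-1}ab = a^{-1}\rangle.$$ Then $C(G)$ possesses a breaking point if and only if $G$ is either cyclic of order at least $p^2$ or a generalized quaternion 2-group. -/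

import Mathlib

/-- The poset `C(G)` of cyclic subgroups of `G`, as a set of subgroups ordered by inclusion. -/
def cyclicSubgroups (G : Type*) [Group G] : Set (Subgroup G) :=
  {H | IsCyclic H}

/-- `H` is a breaking point of a family `P` of subgroups of `G` (ordered by inclusion): it is a
proper nontrivial subgroup of `G` lying in `P`, and it is comparable with every member of `P`. -/
def IsBreakingPoint {G : Type*} [Group G] (P : Set (Subgroup G)) (H : Subgroup G) : Prop :=
  H ∈ P ∧ H ≠ ⊥ ∧ H ≠ ⊤ ∧ ∀ X ∈ P, X ≤ H ∨ H ≤ X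

/-- `G` is a generalized quaternion 2-group: for some `n ≥ 3` it is isomorphic to the group
`⟨a, b | a ^ 2 ^ (n - 2) = b ^ 2, a ^ 2 ^ (n - 1) = 1, b⁻¹ * a * b = a⁻¹⟩` of order `2 ^ n`.
Mathlib's `QuaternionGroup m` is the group
`⟨a, x | a ^ (2 * m) = 1, x ^ 2 = a ^ m, x⁻¹ * a * x = a⁻¹⟩` of order `4 * m`;
here `m = 2 ^ (n - 2)`. -/
def IsGeneralizedQuaternionTwoGroup (G : Type*) [Group G] : Prop :=
  ∃ n : ℕ, 3 ≤ n ∧ Nonempty (G ≃* QuaternionGroup (2 ^ (n - 2)))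

/-! A breaking point contains an element `z` of order `p`, and comparability puts `z` in every
nontrivial cyclic subgroup. Conversely, such a `z` generates a breaking point unless it generates
`G`. So the theorem amounts to the classification of finite `p`-groups with one subgroup of order
`p`.

For that, a maximal cyclic normal subgroup `⟨a⟩` containing `z` is its own centralizer. Let `x ∉
⟨a⟩`, `x ^ p = a ^ j`, `x * a * x⁻¹ = a ^ k` and `N = 1 + k + ⋯ + k ^ (p - 1)`. Then `(a ^ i * x) ^
p = a ^ (i * N + j)`. If `a ^ N ≠ 1`, some `i` makes this trivial, which forces `x ∈ ⟨a⟩`. Hence `a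
^ N = 1`, so `p = 2` and `x` inverts `a`. As `-1` is not a square modulo 4, every element outside
`⟨a⟩` inverts `a`; thus `⟨a⟩` has index 2 and `G` is quaternion. -/

/-! ### Congruences modulo prime powers -/

/-- If `w` is prime to `p`, then `i * (p ^ e * w) + p ^ e * j ≡ 0` modulo `p ^ (e + f)` can be solved
for `i`. -/
theorem exists_dvd_mul_add_of_isCoprime {p : ℤ} {e f : ℕ} {w j : ℤ} (hw : IsCoprime w p) :
    ∃ i : ℤ, p ^ (e + f) ∣ i * (p ^ e * w) + p ^ e * j := by
  obtain ⟨u, v, huv⟩ := hw.pow_right (n := f)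
  refine ⟨-(u * j), ?_⟩
  rw [pow_add]
  have h : -(u * j) * (p ^ e * w) + p ^ e * j = p ^ e * (j * (1 - u * w)) := by ring
  rw [h]
  refine mul_dvd_mul_left _ ?_
  exact ⟨j * v, by linear_combination (-j) * huv⟩

theorem sub_one_dvd_geom_sum_sub (n : ℕ) (k : ℤ) : k - 1 ∣ (∑ t ∈ Finset.range n, k ^ t) - n := by
  induction n with
  | zero => simp
  | succ n ih =>
    have h : (∑ t ∈ Finset.range (n + 1), k ^ t) - ((n + 1 : ℕ) : ℤ)
        = ((∑ t ∈ Finset.range n, k ^ t) - n) + (k ^ n - 1) := by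
      rw [Finset.sum_range_succ]; push_cast; ring
    rw [h]
    exact dvd_add ih (sub_one_dvd_pow_sub_one k n)

theorem Int.prime_dvd_sub_one_of_dvd_pow_sub_one {p : ℕ} (hp : p.Prime) {k : ℤ}
    (h : (p : ℤ) ∣ k ^ p - 1) : (p : ℤ) ∣ k - 1 := by
  have := Fact.mk hp
  rw [← ZMod.intCast_zmod_eq_zero_iff_dvd] at h ⊢
  simpa using h

/-- A congruence `i * N + j ≡ 0` modulo `p ^ m`, with `N = 1 + k + ⋯ + k ^ (p - 1)`, is solvable
when `k` has order `p` modulo `p ^ m`, `j` is fixed by `k` and `N` does not vanish. -/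
theorem exists_dvd_mul_geom_sum_add {p m : ℕ} (hp : p.Prime) {k j : ℤ}
    (hkp : (p : ℤ) ^ m ∣ k ^ p - 1) (hk : ¬ (p : ℤ) ^ m ∣ k - 1)
    (hN : ¬ (p : ℤ) ^ m ∣ ∑ t ∈ Finset.range p, k ^ t) (hj : (p : ℤ) ^ m ∣ (k - 1) * j) :
    ∃ i : ℤ, (p : ℤ) ^ m ∣ i * (∑ t ∈ Finset.range p, k ^ t) + j := by
  have hpp : Prime (p : ℤ) := Nat.prime_iff_prime_int.mp hp
  have hp0 : (p : ℤ) ≠ 0 := hpp.ne_zero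
  obtain ⟨m, rfl⟩ : ∃ n, m = n + 1 := by
    cases m with
    | zero => simp at hk
    | succ n => exact ⟨n, rfl⟩
  have hcop : ∀ w : ℤ, ¬ (p : ℤ) ∣ w → IsCoprime w p := fun w hw =>
    ((Prime.coprime_iff_not_dvd hpp).2 hw).symm
  have hpk : (p : ℤ) ∣ k - 1 :=
    Int.prime_dvd_sub_one_of_dvd_pow_sub_one hp ((dvd_pow_self _ m.succ_ne_zero).trans hkp)
  have hgeom := geom_sum_mul k p
  have hNk := sub_one_dvd_geom_sum_sub p k
  set N := ∑ t ∈ Finset.range p, k ^ t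
  have hpN : (p : ℤ) ∣ N := (dvd_sub_left dvd_rfl).1 (hpk.trans hNk)
  rw [← hgeom] at hkp
  -- Since `N ≡ p` modulo `k - 1`, `p` exactly divides `k - 1` or `N`. In the first case `p ^ m`
  -- divides both `j` and `N`; in the second, `p ∣ j` suffices.
  by_cases h2 : (p : ℤ) ^ 2 ∣ N
  · have h2k : ¬ (p : ℤ) ^ 2 ∣ k - 1 := by
      intro h
      have h3 : (p : ℤ) ^ 2 ∣ p := (dvd_sub_right h2).1 (h.trans hNk)
      rw [pow_two] at h3
      have h4 := (mul_dvd_mul_iff_left hp0).1 (h3.trans (mul_one (p : ℤ)).symm.dvd)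
      exact hpp.not_isUnit (isUnit_of_dvd_one h4)
    obtain ⟨u, hu⟩ := hpk
    have hu' : ¬ (p : ℤ) ∣ u := fun h => h2k (by
      rw [hu, pow_two]; exact mul_dvd_mul_left _ h)
    have hucop := ((hcop u hu').pow_right (n := m)).symm
    rw [hu, pow_succ', mul_assoc, mul_dvd_mul_iff_left hp0] at hj
    rw [hu, mul_left_comm, pow_succ', mul_dvd_mul_iff_left hp0] at hkp
    obtain ⟨j', rfl⟩ := hucop.dvd_of_dvd_mul_left hj
    obtain ⟨w, hw⟩ := hucop.dvd_of_dvd_mul_right hkp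
    rw [hw] at hN ⊢
    refine exists_dvd_mul_add_of_isCoprime (hcop w fun h => hN ?_)
    rw [pow_succ]
    exact mul_dvd_mul_left _ h
  · obtain ⟨w, hw⟩ := hpN
    have hw' : ¬ (p : ℤ) ∣ w := fun h => h2 (by rw [hw, pow_two]; exact mul_dvd_mul_left _ h)
    have hpj : (p : ℤ) ∣ j := by
      by_contra h
      exact hk (((hcop j h).pow_right (n := m + 1)).symm.dvd_of_dvd_mul_right hj)
    obtain ⟨j', rfl⟩ := hpj
    rw [hw]
    have := exists_dvd_mul_add_of_isCoprime (e := 1) (f := m) (j := j') (hcop w hw')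
    rwa [pow_one, add_comm 1 m] at this

/-- For odd `p` and `k ≡ 1` modulo `p`, the sum is `p` modulo `p ^ 2`, while the first two
hypotheses on `k` force `m ≥ 2`. -/
theorem eq_two_of_dvd_geom_sum {p m : ℕ} (hp : p.Prime) {k : ℤ}
    (hkp : (p : ℤ) ^ m ∣ k ^ p - 1) (hk : ¬ (p : ℤ) ^ m ∣ k - 1)
    (hN : (p : ℤ) ^ m ∣ ∑ t ∈ Finset.range p, k ^ t) : p = 2 := by
  by_contra hp2
  have hpp : Prime (p : ℤ) := Nat.prime_iff_prime_int.mp hp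
  have hm : m ≠ 0 := by rintro rfl; simp at hk
  have hpk : (p : ℤ) ∣ k - 1 :=
    Int.prime_dvd_sub_one_of_dvd_pow_sub_one hp ((dvd_pow_self _ hm).trans hkp)
  have hm2 : 2 ≤ m := by
    by_contra h
    obtain rfl : m = 1 := by omega
    exact hk (by simpa using hpk)
  obtain ⟨c, hc⟩ := hpk
  obtain rfl : k = 1 + p * c := by linarith
  have h := odd_sq_dvd_geom_sum₂_sub (a := (1 : ℤ)) (b := c) (hp.odd_of_ne_two hp2)
  simp only [one_pow, mul_one] at h
  have h3 : (p : ℤ) ^ 2 ∣ p := (dvd_sub_right ((pow_dvd_pow _ hm2).trans hN)).1 h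
  rw [pow_two] at h3
  have h4 := (mul_dvd_mul_iff_left hpp.ne_zero).1 (h3.trans (mul_one (p : ℤ)).symm.dvd)
  exact hpp.not_isUnit (isUnit_of_dvd_one h4)

/-! ### Central elements and conjugation in `p`-groups -/

/-- Conjugation on `N` fixes 1, and `p` divides `Nat.card N`, so there is another fixed point. -/
theorem IsPGroup.exists_mem_center_of_normal {p : ℕ} [Fact p.Prime] {G : Type*} [Group G] [Finite G]
    (hG : IsPGroup p G) (N : Subgroup G) [N.Normal] (hN : N ≠ ⊥) :
    ∃ y ∈ N, y ∈ Subgroup.center G ∧ y ≠ 1 := by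
  have hG' : IsPGroup p (ConjAct G) := hG.of_equiv ConjAct.toConjAct
  have hdvd : p ∣ Nat.card N := by
    rcases (hG.to_subgroup N).card_eq_or_dvd with h | h
    · exact absurd (Subgroup.card_eq_one.1 h) hN
    · exact h
  obtain ⟨b, hb, hb1⟩ := hG'.exists_fixed_point_of_prime_dvd_card_of_fixed_point (α := N) hdvd
    (a := 1) (fun g => smul_one g)
  refine ⟨b, b.2, ?_, fun h => hb1 (Subtype.ext h.symm)⟩
  rw [Subgroup.mem_center_iff]
  intro g
  have h := congrArg Subtype.val (hb (ConjAct.toConjAct g))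
  rw [ConjAct.Subgroup.val_conj_smul, ConjAct.toConjAct_smul] at h
  exact mul_inv_eq_iff_eq_mul.1 h

/-- Between normal subgroups `A < C` of a finite `p`-group there is an element of `C` that has
order `p` and is central modulo `A`. -/
theorem IsPGroup.exists_central_mod {p : ℕ} [Fact p.Prime] {G : Type*} [Group G] [Finite G]
    (hG : IsPGroup p G) (A C : Subgroup G) [A.Normal] [C.Normal] (hCA : ¬ C ≤ A) :
    ∃ x ∈ C, x ∉ A ∧ x ^ p ∈ A ∧ ∀ g : G, x⁻¹ * (g * x * g⁻¹) ∈ A := by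
  have hN : C.map (QuotientGroup.mk' A) ≠ ⊥ := by
    rw [Ne, Subgroup.map_eq_bot_iff, QuotientGroup.ker_mk']
    exact hCA
  have : (C.map (QuotientGroup.mk' A)).Normal :=
    Subgroup.Normal.map inferInstance _ (QuotientGroup.mk'_surjective A)
  have hQ := hG.to_quotient A
  obtain ⟨y, hyN, hyZ, hy1⟩ := hQ.exists_mem_center_of_normal _ hN
  obtain ⟨s, hs⟩ := IsPGroup.iff_orderOf.1 hQ y
  obtain ⟨s, rfl⟩ : ∃ t, s = t + 1 := by
    cases s with
    | zero => exact absurd (orderOf_eq_one_iff.1 (by simpa using hs)) hy1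
    | succ t => exact ⟨t, rfl⟩
  obtain ⟨x, hxC, hx⟩ := pow_mem hyN (p ^ s)
  have hxZ : (QuotientGroup.mk' A) x ∈ Subgroup.center (G ⧸ A) := hx ▸ pow_mem hyZ _
  refine ⟨x, hxC, fun h => ?_, ?_, fun g => ?_⟩
  · have h1 : (QuotientGroup.mk' A) x = 1 := (QuotientGroup.eq_one_iff x).2 h
    rw [h1] at hx
    have h2 := orderOf_dvd_of_pow_eq_one hx.symm
    rw [hs] at h2
    exact absurd ((Nat.pow_dvd_pow_iff_le_right (Fact.out : p.Prime).one_lt).1 h2) (by omega)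
  · rw [← QuotientGroup.eq_one_iff]
    change (QuotientGroup.mk' A) (x ^ p) = 1
    rw [map_pow, hx, ← pow_mul, ← pow_succ, ← hs, pow_orderOf_eq_one]
  · rw [← QuotientGroup.eq_one_iff]
    change (QuotientGroup.mk' A) (x⁻¹ * (g * x * g⁻¹)) = 1
    have := Subgroup.mem_center_iff.1 hxZ ((QuotientGroup.mk' A) g)
    rw [map_mul, map_mul, map_mul, this, map_inv, map_inv]
    group

theorem mul_pow_of_conj_zpow {G : Type*} [Group G] {a x : G} {k : ℤ} (h : x * a * x⁻¹ = a ^ k)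
    (i : ℤ) (n : ℕ) : (a ^ i * x) ^ n = a ^ (i * ∑ t ∈ Finset.range n, k ^ t) * x ^ n := by
  have hc : ∀ e : ℤ, x * a ^ e = a ^ (k * e) * x := fun e => by
    rw [zpow_mul, ← h, conj_zpow, inv_mul_cancel_right]
  induction n with
  | zero => simp
  | succ n ih =>
    have hs : ∑ t ∈ Finset.range (n + 1), k ^ t = k * (∑ t ∈ Finset.range n, k ^ t) + 1 := by
      rw [Finset.sum_range_succ', Finset.mul_sum]
      simp [pow_succ']
    rw [pow_succ', ih, hs, mul_assoc, ← mul_assoc x, hc, pow_succ' x, ← mul_assoc, ← mul_assoc,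
      ← zpow_add, mul_assoc]
    congr 2
    ring

theorem conj_pow_zpow {G : Type*} [Group G] {a x : G} {k : ℤ} (h : x * a * x⁻¹ = a ^ k) (n : ℕ) :
    x ^ n * a * (x ^ n)⁻¹ = a ^ k ^ n := by
  induction n with
  | zero => simp
  | succ n ih =>
    have : x ^ (n + 1) * a * (x ^ (n + 1))⁻¹ = x * (x ^ n * a * (x ^ n)⁻¹) * x⁻¹ := by
      rw [pow_succ']; group
    rw [this, ih, ← conj_zpow, h, ← zpow_mul, pow_succ']

theorem exists_pow_notMem_of_isPGroup {p : ℕ} {G : Type*} [Group G] (hG : IsPGroup p G)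
    {A : Subgroup G} {x : G} (hx : x ∉ A) : ∃ s : ℕ, x ^ p ^ s ∉ A ∧ x ^ p ^ (s + 1) ∈ A := by
  classical
  have hex : ∃ s, x ^ p ^ s ∈ A := by
    obtain ⟨k, hk⟩ := isPGroup_iff_pow_pow_eq_one.1 hG x
    exact ⟨k, hk ▸ one_mem A⟩
  obtain ⟨t, ht⟩ : ∃ t, Nat.find hex = t + 1 := by
    refine Nat.exists_eq_succ_of_ne_zero fun h => hx ?_
    simpa [h] using Nat.find_spec hex
  exact ⟨t, Nat.find_min hex (by omega), ht ▸ Nat.find_spec hex⟩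

/-- A group with elements satisfying the defining relations of the quaternion group of order `4 * n`,
for which the cyclic part has two cosets, is that quaternion group. -/
theorem nonempty_mulEquiv_quaternionGroup {G : Type*} [Group G] {n : ℕ} {a x : G}
    (ha : orderOf a = 2 * n) (hx2 : x ^ 2 = a ^ n) (hxa : x * a * x⁻¹ = a⁻¹)
    (hx : x ∉ Subgroup.zpowers a)
    (hcov : ∀ g : G, g ∈ Subgroup.zpowers a ∨ x⁻¹ * g ∈ Subgroup.zpowers a) :
    Nonempty (G ≃* QuaternionGroup n) := by
  have hc : ∀ e : ℤ, a ^ e * x = x * a ^ (-e) := fun e => by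
    have h1 : x * a ^ (-e) * x⁻¹ = a ^ e := by
      rw [← conj_zpow, hxa, inv_zpow, zpow_neg, inv_inv]
    rw [← h1]; group
  let f : ZMod (2 * n) → G := fun i => a ^ (i.cast : ℤ)
  have hf : ∀ e : ℤ, f e = a ^ e := fun e => by
    change a ^ (((e : ZMod (2 * n)).cast : ℤ)) = a ^ e
    rw [zpow_eq_zpow_iff_modEq, ha, ← ZMod.intCast_eq_intCast_iff, ZMod.intCast_zmod_cast]
  have hfadd : ∀ i j, f (i + j) = f i * f j := fun i j => by
    obtain ⟨i, rfl⟩ := ZMod.intCast_surjective i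
    obtain ⟨j, rfl⟩ := ZMod.intCast_surjective j
    rw [← Int.cast_add, hf, hf, hf, zpow_add]
  have hf0 : f 0 = 1 := by simpa using hf 0
  have hfneg : ∀ i, f (-i) = (f i)⁻¹ := fun i =>
    eq_inv_of_mul_eq_one_left (by rw [← hfadd, neg_add_cancel, hf0])
  have hfn : f n = x ^ 2 := by
    have := hf n
    rw [Int.cast_natCast, zpow_natCast] at this
    rw [this, hx2]
  have hfx : ∀ i, f i * x = x * f (-i) := fun i => by
    obtain ⟨i, rfl⟩ := ZMod.intCast_surjective i
    rw [← Int.cast_neg, hf, hf, hc]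
  have hfmem : ∀ i, f i ∈ Subgroup.zpowers a := fun i => Subgroup.zpow_mem_zpowers _ _
  let φ : QuaternionGroup n →* G :=
    { toFun := fun g => match g with
        | .a i => f i
        | .xa i => x * f i
      map_one' := hf0
      map_mul' := by
        rintro (i | i) (j | j)
        · exact hfadd i j
        · change x * f (j - i) = f i * (x * f j)
          rw [← mul_assoc, hfx, mul_assoc, ← hfadd, sub_eq_neg_add]
        · change x * f (i + j) = x * f i * f j
          rw [hfadd, mul_assoc]
        · change f (n + j - i) = x * f i * (x * f j)
          rw [mul_assoc, ← mul_assoc (f i), hfx, mul_assoc, ← mul_assoc x, ← pow_two, ← hfadd, ← hfn,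
            ← hfadd]
          congr 1
          ring }
  refine ⟨(MulEquiv.ofBijective φ ⟨(injective_iff_map_eq_one φ).2 ?_, fun g => ?_⟩).symm⟩
  · rintro (i | i) h
    · obtain ⟨i, rfl⟩ := ZMod.intCast_surjective i
      change f i = 1 at h
      rw [hf, ← orderOf_dvd_iff_zpow_eq_one, ha] at h
      rw [(ZMod.intCast_zmod_eq_zero_iff_dvd _ _).2 h]
      rfl
    · change x * f i = 1 at h
      exact absurd (eq_inv_of_mul_eq_one_left h ▸ inv_mem (hfmem i)) hx
  · rcases hcov g with ⟨e, he⟩ | ⟨e, he⟩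
    · exact ⟨.a e, (hf e).trans he⟩
    · refine ⟨.xa e, ?_⟩
      change x * f e = g
      rw [hf]
      exact eq_inv_mul_iff_mul_eq.1 he

/-! ### Groups with a unique subgroup of order `p` -/

section UniqueMinimal

variable {p : ℕ} {G : Type*} [Group G] [Finite G] {z : G}

theorem mem_of_pow_eq_one_of_forall_mem_zpowers (hp : p.Prime) (hzp : orderOf z = p)
    (hz : ∀ x : G, x ≠ 1 → z ∈ Subgroup.zpowers x) {A : Subgroup G} (hA : z ∈ A) {x : G}
    (hx : x ^ p = 1) : x ∈ A := by
  by_cases hx1 : x = 1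
  · exact hx1 ▸ one_mem A
  · have := Fact.mk hp
    have hox : orderOf x = p := orderOf_eq_prime hx hx1
    have h : Subgroup.zpowers z = Subgroup.zpowers x :=
      Subgroup.eq_of_le_of_card_ge (Subgroup.zpowers_le.2 (hz x hx1))
        (by rw [Nat.card_zpowers, Nat.card_zpowers, hzp, hox])
    exact Subgroup.zpowers_le.2 hA (h ▸ Subgroup.mem_zpowers x)

/-- A finite `p`-group with a unique subgroup of order `p` has a self-centralizing cyclic normal
subgroup. -/
theorem IsPGroup.exists_normal_zpowers_self_centralizing (hp : p.Prime) (hG : IsPGroup p G)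
    (hzp : orderOf z = p) (hz : ∀ x : G, x ≠ 1 → z ∈ Subgroup.zpowers x) :
    ∃ a : G, (Subgroup.zpowers a).Normal ∧ z ∈ Subgroup.zpowers a ∧
      ∀ x : G, Commute x a → x ∈ Subgroup.zpowers a := by
  have := Fact.mk hp
  have hz1 : z ≠ 1 := fun h => hp.one_lt.ne' (hzp ▸ orderOf_eq_one_iff.2 h)
  have hzc : z ∈ Subgroup.center G := by
    obtain ⟨y, -, hy, hy1⟩ := hG.exists_mem_center_of_normal ⊤
      (fun h => hz1 (Subgroup.mem_bot.1 (h ▸ Subgroup.mem_top z)))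
    exact Subgroup.zpowers_le.2 hy (hz y hy1)
  have hzn : (Subgroup.zpowers z).Normal :=
    ⟨fun y hy g => by
      have h := Subgroup.mem_center_iff.1 (Subgroup.zpowers_le.2 hzc hy) g
      rwa [h, mul_inv_cancel_right]⟩
  obtain ⟨A, -, ⟨⟨a, rfl⟩, hAn, hzA⟩, hmax⟩ := Finite.exists_le_maximal
    (p := fun A : Subgroup G => (∃ a, Subgroup.zpowers a = A) ∧ A.Normal ∧ z ∈ A)
    (a := Subgroup.zpowers z) ⟨⟨z, rfl⟩, hzn, Subgroup.mem_zpowers z⟩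
  refine ⟨a, hAn, hzA, ?_⟩
  by_contra! hcon
  obtain ⟨y, hya, hyA⟩ := hcon
  obtain ⟨x, hxC, hxA, hxp, hxg⟩ := hG.exists_central_mod (Subgroup.zpowers a)
    (Subgroup.centralizer (Subgroup.zpowers a : Set G)) (fun h => hyA (h (by
      rw [Subgroup.mem_centralizer_iff]
      rintro _ ⟨e, rfl⟩
      exact (hya.zpow_right e).eq.symm)))
  have hxa : Commute x a :=
    (Subgroup.mem_centralizer_iff.1 hxC a (Subgroup.mem_zpowers a)).symm
  obtain ⟨j, hj⟩ := hxp
  change a ^ j = x ^ p at hj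
  -- If `j = p * i`, then `x * a ^ (-i)` has trivial `p`-th power. Otherwise `a` is a power of `x ^
  -- p`, and `⟨x⟩` contradicts maximality.
  by_cases hpj : (p : ℤ) ∣ j
  · obtain ⟨i, rfl⟩ := hpj
    have h1 : (x * a ^ (-i)) ^ p = 1 := by
      rw [(hxa.zpow_right (-i)).mul_pow, ← hj, ← zpow_natCast, ← zpow_mul, ← zpow_add]
      convert zpow_zero a using 2
      ring
    have h2 := mem_of_pow_eq_one_of_forall_mem_zpowers hp hzp hz hzA h1
    exact hxA ((Subgroup.mul_mem_cancel_right _ (Subgroup.zpow_mem_zpowers a _)).1 h2)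
  · obtain ⟨m, hm⟩ := IsPGroup.iff_orderOf.1 hG a
    obtain ⟨u, v, huv⟩ := (((Prime.coprime_iff_not_dvd (Nat.prime_iff_prime_int.mp hp)).2
      hpj).symm.pow_right (n := m))
    have hax : a ∈ Subgroup.zpowers x := by
      have h1 : a = (x ^ p) ^ u := by
        have h2 : a ^ ((p : ℤ) ^ m) = 1 := by
          rw [← orderOf_dvd_iff_zpow_eq_one, hm]; push_cast; rfl
        calc a = a ^ (u * j + v * (p : ℤ) ^ m) := by rw [huv, zpow_one]
          _ = _ := by
            rw [zpow_add, mul_comm v, zpow_mul a _ v, h2, one_zpow, mul_one, mul_comm, zpow_mul, hj]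
      rw [h1]
      exact zpow_mem (pow_mem (Subgroup.mem_zpowers x) _) _
    have hle : Subgroup.zpowers a ≤ Subgroup.zpowers x := Subgroup.zpowers_le.2 hax
    refine hxA (hmax ⟨⟨x, rfl⟩, ⟨?_⟩, hle hzA⟩ hle (Subgroup.mem_zpowers x))
    rintro _ ⟨e, rfl⟩ g
    change g * x ^ e * g⁻¹ ∈ _
    rw [← conj_zpow]
    exact zpow_mem ((Subgroup.mul_mem_cancel_left _
      (inv_mem (Subgroup.mem_zpowers x))).1 (hle (hxg g))) _

/-- In a finite `p`-group with a unique subgroup of order `p`, an element of order `p` modulo a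
self-centralizing cyclic normal subgroup inverts it, and `p = 2`. -/
theorem IsPGroup.conj_eq_inv_of_self_centralizing (hp : p.Prime) (hG : IsPGroup p G)
    (hzp : orderOf z = p) (hz : ∀ x : G, x ≠ 1 → z ∈ Subgroup.zpowers x) {a : G}
    (hAn : (Subgroup.zpowers a).Normal) (hzA : z ∈ Subgroup.zpowers a)
    (hC : ∀ x : G, Commute x a → x ∈ Subgroup.zpowers a) {x : G} (hx : x ∉ Subgroup.zpowers a)
    (hxp : x ^ p ∈ Subgroup.zpowers a) : p = 2 ∧ x * a * x⁻¹ = a⁻¹ := by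
  have := Fact.mk hp
  obtain ⟨m, hm⟩ := IsPGroup.iff_orderOf.1 hG a
  have hone : ∀ e : ℤ, (p : ℤ) ^ m ∣ e ↔ a ^ e = 1 := fun e => by
    rw [← orderOf_dvd_iff_zpow_eq_one, hm, Nat.cast_pow]
  have hsub : ∀ e e' : ℤ, (p : ℤ) ^ m ∣ e - e' ↔ a ^ e = a ^ e' := fun e e' => by
    rw [hone, zpow_sub, mul_inv_eq_one]
  obtain ⟨k, hk⟩ := hAn.conj_mem a (Subgroup.mem_zpowers a) x
  obtain ⟨j, hj⟩ := hxp
  change a ^ k = _ at hk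
  change a ^ j = _ at hj
  -- The next three facts say that `x` does not centralize `a`, that `x ^ p` does, and that `x`
  -- commutes with `x ^ p`.
  have hk1 : ¬ (p : ℤ) ^ m ∣ k - 1 := by
    rw [hsub, hk, zpow_one, mul_inv_eq_iff_eq_mul]
    exact fun h => hx (hC x h)
  have hkp : (p : ℤ) ^ m ∣ k ^ p - 1 := by
    rw [hsub, ← conj_pow_zpow hk.symm, ← hj, zpow_one, mul_inv_eq_iff_eq_mul]
    exact ((Commute.refl a).zpow_left j).eq
  have hkj : (p : ℤ) ^ m ∣ (k - 1) * j := by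
    rw [sub_mul, one_mul, hsub, zpow_mul, hk, conj_zpow, hj, mul_inv_eq_iff_eq_mul]
    exact ((Commute.refl x).pow_right p).eq
  by_cases hN : (p : ℤ) ^ m ∣ ∑ t ∈ Finset.range p, k ^ t
  · obtain rfl := eq_two_of_dvd_geom_sum hp hkp hk1 hN
    refine ⟨rfl, ?_⟩
    rw [← hk, ← zpow_neg_one, ← hsub]
    simpa [Finset.sum_range_succ, add_comm] using hN
  · obtain ⟨i, hi⟩ := exists_dvd_mul_geom_sum_add hp hkp hk1 hN hkj
    have h1 : (a ^ i * x) ^ p = 1 := by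
      rw [mul_pow_of_conj_zpow hk.symm, ← hj, ← zpow_add, ← hone]
      exact hi
    have h2 := mem_of_pow_eq_one_of_forall_mem_zpowers hp hzp hz hzA h1
    exact absurd ((Subgroup.mul_mem_cancel_left _ (Subgroup.zpow_mem_zpowers a _)).1 h2) hx

/-- A finite `p`-group with a unique subgroup of order `p` is cyclic or generalized quaternion. -/
theorem IsPGroup.isCyclic_or_isGeneralizedQuaternionTwoGroup (hp : p.Prime) (hG : IsPGroup p G)
    (hzp : orderOf z = p) (hz : ∀ x : G, x ≠ 1 → z ∈ Subgroup.zpowers x) :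
    IsCyclic G ∨ IsGeneralizedQuaternionTwoGroup G := by
  have := Fact.mk hp
  obtain ⟨a, hAn, hzA, hC⟩ := hG.exists_normal_zpowers_self_centralizing hp hzp hz
  by_cases hall : ∀ g : G, g ∈ Subgroup.zpowers a
  · exact Or.inl ⟨a, hall⟩
  right
  have key : ∀ y : G, y ∉ Subgroup.zpowers a → y ^ p ∈ Subgroup.zpowers a →
      p = 2 ∧ y * a * y⁻¹ = a⁻¹ := fun y =>
    hG.conj_eq_inv_of_self_centralizing hp hzp hz hAn hzA hC
  obtain ⟨g₀, hg₀⟩ := not_forall.1 hall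
  obtain ⟨s₀, hx, hxp⟩ := exists_pow_notMem_of_isPGroup hG hg₀
  rw [pow_succ, pow_mul] at hxp
  obtain ⟨hp2, hxa⟩ := key _ hx hxp
  subst hp2
  generalize g₀ ^ 2 ^ s₀ = x at hx hxp hxa
  obtain ⟨m, hm⟩ := IsPGroup.iff_orderOf.1 hG a
  have hne : a ^ 2 ≠ 1 := by
    intro h
    have hinv : a⁻¹ = a := inv_eq_of_mul_eq_one_left (by rw [← pow_two, h])
    rw [hinv, mul_inv_eq_iff_eq_mul] at hxa
    exact hx (hC x hxa)
  obtain ⟨m, rfl⟩ : ∃ r, m = r + 2 := by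
    refine Nat.exists_eq_add_of_le' ?_
    by_contra hlt
    refine hne (orderOf_dvd_iff_pow_eq_one.1 (hm ▸ ?_))
    simpa using pow_dvd_pow 2 (show m ≤ 1 by omega)
  have hinv : ∀ g : G, g ∉ Subgroup.zpowers a → g * a * g⁻¹ = a⁻¹ := by
    intro g hg
    obtain ⟨s, hs, hs'⟩ := exists_pow_notMem_of_isPGroup hG hg
    rw [pow_succ, pow_mul] at hs'
    obtain ⟨-, hsa⟩ := key _ hs hs'
    -- For `s > 0` the inverting element is a square, making `-1` a square modulo 4.
    cases s with
    | zero => simpa using hsa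
    | succ s =>
      rw [pow_succ, pow_mul] at hsa
      obtain ⟨k, hk⟩ := hAn.conj_mem a (Subgroup.mem_zpowers a) (g ^ 2 ^ s)
      change a ^ k = _ at hk
      rw [conj_pow_zpow hk.symm, ← zpow_neg_one, zpow_eq_zpow_iff_modEq, hm] at hsa
      have h4 : k ^ 2 ≡ -1 [ZMOD 4] := hsa.of_dvd (by
        push_cast; exact ⟨2 ^ m, by ring⟩)
      have h5 : ∀ c : ZMod 4, c ^ 2 ≠ -1 := by decide
      refine absurd ?_ (h5 k)
      have := (ZMod.intCast_eq_intCast_iff _ _ 4).2 h4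
      simpa using this
  -- `x` both inverts and fixes `x ^ 2 = a ^ j`, so `j` is a multiple of half the order of `a`. An
  -- even multiple would give `x ^ 2 = 1`, hence `x ∈ ⟨a⟩`.
  have hx2 : x ^ 2 = a ^ 2 ^ (m + 1) := by
    obtain ⟨j, hj⟩ := hxp
    change a ^ j = _ at hj
    have h1 : a ^ (-j) = a ^ j := by
      rw [zpow_neg, ← inv_zpow, ← hxa, conj_zpow, hj, mul_inv_eq_iff_eq_mul]
      exact ((Commute.refl x).pow_right 2).eq
    rw [zpow_eq_zpow_iff_modEq, hm] at h1
    have h2 : ((2 : ℤ) ^ (m + 1)) ∣ j := by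
      have h3 := h1.dvd
      have h4 : (2 : ℤ) * 2 ^ (m + 1) ∣ 2 * j := by
        convert h3 using 1
        · push_cast; ring
        · ring
      exact (mul_dvd_mul_iff_left two_ne_zero).1 h4
    obtain ⟨c, rfl⟩ := h2
    have hb : (a ^ ((2 : ℤ) ^ (m + 1))) ^ 2 = 1 := by
      rw [← zpow_natCast, ← zpow_mul, ← orderOf_dvd_iff_zpow_eq_one, hm]
      push_cast
      exact ⟨1, by ring⟩
    have hb' : a ^ ((2 : ℤ) ^ (m + 1)) = a ^ 2 ^ (m + 1) := by
      rw [← zpow_natCast]; push_cast; rfl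
    rcases Int.even_or_odd c with ⟨d, rfl⟩ | ⟨d, rfl⟩
    · refine absurd (mem_of_pow_eq_one_of_forall_mem_zpowers hp hzp hz hzA ?_) hx
      rw [← hj, zpow_mul, ← two_mul, zpow_mul]
      rw [zpow_ofNat, hb, one_zpow]
    · rw [← hj, zpow_mul, zpow_add, zpow_mul, zpow_ofNat, hb, one_zpow, one_mul, zpow_one, hb']
  refine ⟨m + 3, by omega, ?_⟩
  refine nonempty_mulEquiv_quaternionGroup (a := a) (x := x) (n := 2 ^ (m + 1))
    (by rw [hm]; ring) hx2 hxa hx fun g => ?_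
  by_cases hg : g ∈ Subgroup.zpowers a
  · exact Or.inl hg
  -- Both `x` and `g` invert `a`, so `x⁻¹ * g` centralizes it.
  · refine Or.inr (hC _ ?_)
    have h1 : x⁻¹ * a⁻¹ * x = a := by rw [← hxa]; group
    have h2 : x⁻¹ * g * a * (x⁻¹ * g)⁻¹ = a := by
      calc x⁻¹ * g * a * (x⁻¹ * g)⁻¹ = x⁻¹ * (g * a * g⁻¹) * x := by group
        _ = a := by rw [hinv g hg, h1]
    exact mul_inv_eq_iff_eq_mul.1 h2

end UniqueMinimal

/-! ### Breaking points and the central involution -/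

/-- With `n = orderOf x`, the equation `y ^ n = 1` has at most `n` solutions in `K`, and the powers
of `x` already supply `n`. -/
theorem Subgroup.mem_zpowers_of_orderOf_dvd {G : Type*} [Group G] [Finite G] (K : Subgroup G)
    [IsCyclic K] {x z : G} (hx : x ∈ K) (hz : z ∈ K) (h : orderOf z ∣ orderOf x) :
    z ∈ Subgroup.zpowers x := by
  classical
  have := Fintype.ofFinite K
  let x' : K := ⟨x, hx⟩
  let z' : K := ⟨z, hz⟩
  have hle := IsCyclic.card_pow_eq_one_le (α := K) (orderOf_pos x')
  have hsub : Finset.univ.filter (fun y : K => y ∈ Subgroup.zpowers x') ⊆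
      Finset.univ.filter (fun y : K => y ^ orderOf x' = 1) := fun y hy => by
    simp only [Finset.mem_filter, Finset.mem_univ, true_and] at hy ⊢
    exact orderOf_dvd_iff_pow_eq_one.1 (orderOf_dvd_of_mem_zpowers hy)
  have hcard : (Finset.univ.filter (fun y : K => y ∈ Subgroup.zpowers x')).card = orderOf x' := by
    rw [← Nat.card_zpowers, Nat.card_eq_fintype_card, Fintype.card_subtype]
  have heq := Finset.eq_of_subset_of_card_le hsub (hcard ▸ hle)
  have hz' : z' ∈ Finset.univ.filter (fun y : K => y ∈ Subgroup.zpowers x') := by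
    rw [heq, Finset.mem_filter, ← orderOf_dvd_iff_pow_eq_one, ← Subgroup.orderOf_coe,
      ← Subgroup.orderOf_coe]
    exact ⟨Finset.mem_univ _, h⟩
  obtain ⟨e, he⟩ := (Finset.mem_filter.1 hz').2
  exact ⟨e, congrArg Subtype.val he⟩

/-- The subgroup of order `p` inside a breaking point lies in every nontrivial cyclic subgroup. -/
theorem IsBreakingPoint.exists_orderOf_eq_prime {p : ℕ} {G : Type*} [Group G] [Finite G]
    (hp : p.Prime) (hG : IsPGroup p G) {H : Subgroup G}
    (hH : IsBreakingPoint (cyclicSubgroups G) H) :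
    ∃ z : G, orderOf z = p ∧ ∀ x : G, x ≠ 1 → z ∈ Subgroup.zpowers x := by
  have := Fact.mk hp
  obtain ⟨hcyc, hbot, -, hcomp⟩ := hH
  have hcyc : IsCyclic H := hcyc
  obtain ⟨z, hz⟩ := exists_prime_orderOf_dvd_card' (G := H) p
    ((hG.to_subgroup H).card_eq_or_dvd.resolve_left fun h => hbot (Subgroup.card_eq_one.1 h))
  refine ⟨z, by rw [Subgroup.orderOf_coe, hz], fun x hx => ?_⟩
  rcases hcomp (Subgroup.zpowers x) (Subgroup.isCyclic_zpowers x) with h | h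
  · refine Subgroup.mem_zpowers_of_orderOf_dvd H (h (Subgroup.mem_zpowers x)) z.2 ?_
    rw [Subgroup.orderOf_coe, hz]
    exact hG.dvd_orderOf hx
  · exact h z.2

/-- If all nontrivial cyclic subgroups of a group of order not `orderOf z` contain `z`, then `z`
generates a breaking point. -/
theorem isBreakingPoint_zpowers {G : Type*} [Group G] {z : G} (hz1 : z ≠ 1)
    (hcard : Nat.card G ≠ orderOf z) (hz : ∀ x : G, x ≠ 1 → z ∈ Subgroup.zpowers x) :
    IsBreakingPoint (cyclicSubgroups G) (Subgroup.zpowers z) := by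
  refine ⟨Subgroup.isCyclic_zpowers z, by simpa using hz1, fun h => hcard ?_, fun X hX => ?_⟩
  · rw [← Nat.card_zpowers, h, Subgroup.card_top]
  · obtain ⟨x, rfl⟩ := (Subgroup.isCyclic_iff_exists_zpowers_eq_top X).1 hX
    by_cases hx : x = 1
    · left; simp [hx]
    · right; exact Subgroup.zpowers_le.2 (hz x hx)

theorem QuaternionGroup.isPGroup_two (r : ℕ) : IsPGroup 2 (QuaternionGroup (2 ^ r)) :=
  IsPGroup.of_card (n := r + 2) (by
    rw [Nat.card_eq_fintype_card, QuaternionGroup.card]; ring)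

/-- The central involution of a generalized quaternion group. -/
theorem QuaternionGroup.orderOf_a_natCast_self {n : ℕ} [NeZero n] :
    orderOf (QuaternionGroup.a (n : ZMod (2 * n)) : QuaternionGroup n) = 2 := by
  rw [← QuaternionGroup.xa_sq 0, orderOf_pow, QuaternionGroup.orderOf_xa]
  rfl

theorem QuaternionGroup.a_natCast_self_mem_zpowers {r : ℕ} {g : QuaternionGroup (2 ^ r)}
    (hg : g ≠ 1) :
    (QuaternionGroup.a ((2 ^ r : ℕ) : ZMod (2 * 2 ^ r)) : QuaternionGroup (2 ^ r)) ∈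
      Subgroup.zpowers g := by
  have hdvd := (QuaternionGroup.isPGroup_two r).dvd_orderOf hg
  have hmem : ∀ i : ZMod (2 * 2 ^ r), (QuaternionGroup.a i : QuaternionGroup (2 ^ r)) ∈
      Subgroup.zpowers (QuaternionGroup.a 1 : QuaternionGroup (2 ^ r)) := fun i => by
    obtain ⟨i, rfl⟩ := ZMod.natCast_zmod_surjective i
    rw [← QuaternionGroup.a_one_pow]
    exact pow_mem (Subgroup.mem_zpowers _) _
  rcases g with i | i
  · refine Subgroup.mem_zpowers_of_orderOf_dvd _ (hmem i) (hmem _) ?_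
    rwa [QuaternionGroup.orderOf_a_natCast_self]
  · rw [← QuaternionGroup.xa_sq i]
    exact pow_mem (Subgroup.mem_zpowers _) _

theorem lemma2p1 {G : Type*} [Group G] [Finite G] (p : ℕ) (hp : p.Prime) (hG : IsPGroup p G) :
    (∃ H : Subgroup G, IsBreakingPoint (cyclicSubgroups G) H) ↔
      ((IsCyclic G ∧ p ^ 2 ≤ Nat.card G) ∨ IsGeneralizedQuaternionTwoGroup G) := by
  have := Fact.mk hp
  constructor
  · rintro ⟨H, hH⟩
    obtain ⟨z, hzp, hz⟩ := hH.exists_orderOf_eq_prime hp hG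
    refine (hG.isCyclic_or_isGeneralizedQuaternionTwoGroup hp hzp hz).imp_left fun hc => ⟨hc, ?_⟩
    obtain ⟨n, hn⟩ := IsPGroup.iff_card.1 hG
    rw [hn]
    refine Nat.pow_le_pow_right hp.pos ?_
    by_contra hlt
    have hcard : Nat.card G ∣ p := by
      rw [hn]; simpa using pow_dvd_pow p (show n ≤ 1 by omega)
    rcases (Nat.dvd_prime hp).1 (H.card_subgroup_dvd_card.trans hcard) with h | h
    · exact hH.2.1 (Subgroup.card_eq_one.1 h)
    · exact hH.2.2.1 (Subgroup.eq_top_of_card_eq H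
        (Nat.dvd_antisymm H.card_subgroup_dvd_card (h ▸ hcard)))
  · rintro (⟨hc, hcard⟩ | ⟨n, hn, ⟨e⟩⟩)
    · have hdvd : p ∣ Nat.card G := hG.card_eq_or_dvd.resolve_left fun h => by
        rw [h] at hcard
        nlinarith [hp.two_le]
      obtain ⟨z, hz⟩ := exists_prime_orderOf_dvd_card' (G := G) p hdvd
      refine ⟨_, isBreakingPoint_zpowers (z := z) ?_ ?_ fun x hx => ?_⟩
      · rintro rfl
        exact hp.one_lt.ne (by simpa using hz)
      · rw [hz]
        nlinarith [hp.two_le]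
      · have h := hz ▸ hG.dvd_orderOf hx
        have : IsCyclic (⊤ : Subgroup G) := Subgroup.isCyclic ⊤
        exact Subgroup.mem_zpowers_of_orderOf_dvd ⊤ (Subgroup.mem_top x) (Subgroup.mem_top z) h
    · set c : QuaternionGroup (2 ^ (n - 2)) := .a ((2 ^ (n - 2) : ℕ))
      have hc : orderOf c = 2 := QuaternionGroup.orderOf_a_natCast_self
      refine ⟨_, isBreakingPoint_zpowers (z := e.symm c) ?_ ?_ fun x hx => ?_⟩
      · intro h
        rw [EmbeddingLike.map_eq_one_iff] at h
        simp [h] at hc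
      · rw [MulEquiv.orderOf_eq, hc, Nat.card_congr e.toEquiv, Nat.card_eq_fintype_card,
          QuaternionGroup.card]
        omega
      · obtain ⟨k, hk⟩ := QuaternionGroup.a_natCast_self_mem_zpowers
          (g := e x) (by simpa using hx)
        refine ⟨k, e.injective ?_⟩
        change e (x ^ k) = e (e.symm c)
        rw [map_zpow, MulEquiv.apply_symm_apply]
        exact hk
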